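/- \textbf{Definitions.} In the game of Cops and Robbers on a finite simple graph $G$, $k$ cops are first placed on a multiset of vertices, then the robber is placed on a vertex; in each round every cop moves to an adjacent vertex or stays in place, and then the robber moves to an adjacent vertex or stays in place. The robber is captured when a cop occupies the robber's vertex. Let $\operatorname{capt}_k(G)$ be the least number of rounds within which $k$ cops can guarantee a capture (initial placements are not counted; $\operatorname{capt}_k(G)=\infty$ if the robber can evade $k$ cops forever). The cop-throttling number of a graph $G$ of order $n$ is $\operatorname{th}_c(G)=\min_{1\le k\le n}\bigl(k+\operatorname{capt}_k(G)\bigr)$. For a positive integer $n$, call a graph $G$ of order $n$ \emph{admissible} if it arises as follows: choose a prime $q$ in the open interval $\left(\left\lfloor\sqrt{n/8}-1\right\rfloor,\,2\left\lfloor\sqrt{n/8}-1\right\rfloor\right)$ (then $2(q^2+q+1)\le n$) and a projective plane of order $q$, take its incidence graph (the bipartite graph on the $2(q^2+q+1)$ points and lines in which a point is adjacent to the lines it lies on), and attach to an arbitrary vertex of it, by one end, a path of length $n-2(q^2+q+1)$. \textbf{Proposition.} For every $n\ge 72$ there is an admissible graph of order $n$. If $\{G_n\}$ is any family of graphs in which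 $G_n$ has order $n$ for every $n$ and is admissible for all sufficiently large $n$, then $$\operatorname{th}_c(G_n)=\Theta(\sqrt n)\qquad (n\to\infty).$$ -/

import Mathlib

open Filter Asymptotics

namespace CopsRobbers

/-- The incidence graph of a configuration of points `P` and lines `L`: bipartite on `P ⊕ L`, a
point being adjacent to the lines it lies on. -/
def incidenceGraph (P L : Type*) [Membership P L] : SimpleGraph (P ⊕ L) where
  Adj
    | .inl p, .inr l => p ∈ l
    | .inr l, .inl p => p ∈ l
    | _, _ => False
  symm := ⟨by rintro (p | l) (p' | l') h <;> exact h⟩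
  loopless := ⟨by rintro (p | l) h <;> exact h⟩

/-- The vertex sum of `G` and `H`: disjoint copies of the two graphs, glued by identifying
the vertex `w` of `H` with the vertex `v` of `G`. -/
def vertexSum {V W : Type*} (G : SimpleGraph V) (H : SimpleGraph W) (v : V) (w : W) :
    SimpleGraph (V ⊕ {x : W // x ≠ w}) where
  Adj
    | .inl a, .inl b => G.Adj a b
    | .inr x, .inr y => H.Adj x y
    | .inl a, .inr x => a = v ∧ H.Adj w x
    | .inr x, .inl a => a = v ∧ H.Adj w x
  symm := ⟨by
    rintro (a | x) (b | y) h
    · exact SimpleGraph.Adj.symm h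
    · exact h
    · exact h
    · exact SimpleGraph.Adj.symm h⟩
  loopless := ⟨by
    rintro (a | x) h
    · exact G.irrefl h
    · exact H.irrefl h⟩

section Game

variable {V : Type*} (G : SimpleGraph V)

/-- A legal move of a single player from `u` to `v`: stay in place or go to a neighbour. -/
def Move (u v : V) : Prop := v = u ∨ G.Adj u v

/-- Some cop occupies the vertex `r`. -/
def Caught {V : Type*} {k : ℕ} (c : Fin k → V) (r : V) : Prop := ∃ i, c i = r

/-- With the `k` cops at `c`, the robber at `r`, and the cops about to move, the cops can force
a capture in at most `t` further rounds. In a round every cop moves first, then the robber. -/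
def CopsWinWithin {k : ℕ} : ℕ → (Fin k → V) → V → Prop
  | 0, c, r => Caught c r
  | t + 1, c, r => Caught c r ∨
      ∃ c' : Fin k → V, (∀ i, Move G (c i) (c' i)) ∧
        (Caught c' r ∨ ∀ r', Move G r r' → CopsWinWithin t c' r')

/-- The `k`-capture time: the least number of rounds `t` such that `k` cops have an initial
placement (on a multiset of vertices) from which, wherever the robber is then placed, they can
force a capture within `t` rounds. It is `⊤` if there is no such `t`. -/
noncomputable def captureTime (k : ℕ) : ℕ∞ :=
  ⨅ (t : ℕ) (_ : ∃ c : Fin k → V, ∀ r, CopsWinWithin G t c r), (t : ℕ∞)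

/-- The cop-throttling number: the minimum of `k + capt_k(G)` over `1 ≤ k ≤ |V|`. -/
noncomputable def copThrottling [Fintype V] : ℕ∞ :=
  ⨅ k ∈ Finset.Icc 1 (Fintype.card V), ((k : ℕ∞) + captureTime G k)

end Game

/-- `G` is a graph of order `n` obtained as follows: choose a prime `q` in the open interval from
`⌊√(n/8) - 1⌋` to `2 ⌊√(n/8) - 1⌋`, a projective plane of order `q`, and a vertex `v` of
its incidence graph, and attach at `v` a path of length `n - 2(q² + q + 1)` by one of its ends. -/
def IsMeynielExtremalGraph (n : ℕ) (G : SimpleGraph (Fin n)) : Prop :=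
  ∃ q : ℕ, q.Prime ∧ ⌊√((n : ℝ) / 8) - 1⌋₊ < q ∧ q < 2 * ⌊√((n : ℝ) / 8) - 1⌋₊ ∧
    ∃ (P L : Type) (_ : Fintype P) (_ : Fintype L) (_ : Membership P L)
      (_ : Configuration.ProjectivePlane P L),
      Configuration.ProjectivePlane.order P L = q ∧
      ∃ (v : P ⊕ L) (m : ℕ), 2 * (q ^ 2 + q + 1) + m = n ∧
        Nonempty (G ≃g vertexSum (incidenceGraph P L) (SimpleGraph.pathGraph (m + 1)) v 0)

end CopsRobbers

/-!
Both bounds come from the structure of an admissible graph: the incidence graph `I` of a plane of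
order `q`, with a path hanging off a vertex `v`, where `q` is of order `√n`.

*Lower bound.* Folding the path onto `v` is a retraction onto `I`, so cops who win on the whole
graph also win on `I` (`CopsWinWithin.of_retract`). In `I` every degree is `q + 1`, and since `I`
has no cycles of length three or four, a cop standing off the robber's vertex `r` guards at most one
neighbour of `r`. Hence `q` cops leave the robber a safe neighbour forever
(`captureTime_eq_top_of_lt_degree`), and the throttling number is at least `q + 1`.

*Upper bound.* The points of one line together with the lines through one point form a dominating
set of `2(q + 1)` vertices of `I`, since any two lines meet and any two points are joined. Cops
placed there catch in a single round any robber in `I`. Further cops at distance `s ≈ √n` from each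
other on the path confine a robber on the path to a segment between two of them; one of the two
stays, the other one walks towards it, and the capture takes at most `s` rounds
(`copsWinWithin_segment`). This uses `O(q + n / s) = O(√n)` cops and `s = O(√n)` rounds.

Existence of admissible graphs is Bertrand's postulate together with the plane over `ZMod q`.
-/

namespace CopsRobbers

/-! ### The game on a general graph -/

section Game

variable {V W : Type*} {G : SimpleGraph V} {H : SimpleGraph W} {k t : ℕ}

theorem Move.refl (G : SimpleGraph V) (u : V) : Move G u u := Or.inl rfl

theorem CopsWinWithin.of_caught {c : Fin k → V} {r : V} (h : Caught c r) :
    CopsWinWithin G t c r := by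
  cases t with
  | zero => exact h
  | succ t => exact Or.inl h

/-- Cops who win on `G` win on a retract `H` of `G`: they play the images of their moves, against a
robber who never leaves the copy of `H`. -/
theorem CopsWinWithin.of_retract {ρ : V → W} {ι : W → V} (hρι : ∀ w, ρ (ι w) = w)
    (hρ : ∀ a b, Move G a b → Move H (ρ a) (ρ b))
    (hι : ∀ a b, Move H a b → Move G (ι a) (ι b)) {c : Fin k → V} {r : W}
    (h : CopsWinWithin G t c (ι r)) : CopsWinWithin H t (ρ ∘ c) r := by
  have caught : ∀ {c : Fin k → V} {r : W}, Caught c (ι r) → Caught (ρ ∘ c) r := by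
    rintro c r ⟨i, hi⟩
    exact ⟨i, by simp [hi, hρι]⟩
  induction t generalizing c r with
  | zero => exact caught h
  | succ t ih =>
    rcases h with h | ⟨c', hm, h⟩
    · exact Or.inl (caught h)
    · refine Or.inr ⟨ρ ∘ c', fun i => hρ _ _ (hm i), ?_⟩
      rcases h with h | h
      · exact Or.inl (caught h)
      · exact Or.inr fun r' hr' => ih (h _ (hι _ _ hr'))

theorem captureTime_le {c : Fin k → V} (h : ∀ r, CopsWinWithin G t c r) :
    captureTime G k ≤ t :=
  iInf₂_le t ⟨c, h⟩

theorem captureTime_le_of_retract {ρ : V → W} {ι : W → V} (hρι : ∀ w, ρ (ι w) = w)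
    (hρ : ∀ a b, Move G a b → Move H (ρ a) (ρ b))
    (hι : ∀ a b, Move H a b → Move G (ι a) (ι b)) :
    captureTime H k ≤ captureTime G k :=
  le_iInf₂ fun _ ⟨_, hc⟩ => captureTime_le fun r => (hc (ι r)).of_retract hρι hρ hι

theorem captureTime_le_of_iso (e : G ≃g H) : captureTime H k ≤ captureTime G k := by
  refine captureTime_le_of_retract (ρ := e) (ι := e.symm) (fun w => e.apply_symm_apply w) ?_ ?_
  · rintro a b (rfl | h)
    exacts [Move.refl _ _, Or.inr (e.map_adj_iff.2 h)]
  · rintro a b (rfl | h)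
    exacts [Move.refl _ _, Or.inr (e.symm.map_adj_iff.2 h)]

theorem captureTime_congr (e : G ≃g H) : captureTime G k = captureTime H k :=
  le_antisymm (captureTime_le_of_iso e.symm) (captureTime_le_of_iso e)

theorem copThrottling_congr [Fintype V] [Fintype W] (e : G ≃g H) :
    copThrottling G = copThrottling H := by
  simp only [copThrottling, Fintype.card_congr e.toEquiv, captureTime_congr e]

/-- It is enough to say which vertices are occupied at the start; surplus cops are harmless. -/
theorem captureTime_le_of_finset (T : Finset V) (hT : T.Nonempty) (hk : T.card ≤ k)
    (h : ∀ c : Fin k → V, (∀ u ∈ T, ∃ i, c i = u) → ∀ r, CopsWinWithin G t c r) :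
    captureTime G k ≤ t := by
  obtain ⟨u₀, -⟩ := hT
  let f : T → Fin k := fun u => Fin.castLE hk (T.equivFin u)
  have hf : Function.Injective f :=
    (Fin.castLE_injective hk).comp T.equivFin.injective
  refine captureTime_le (h (Function.extend f Subtype.val fun _ => u₀) fun u hu => ?_)
  exact ⟨f ⟨u, hu⟩, hf.extend_apply _ _ _⟩

theorem copThrottling_le [Fintype V] (hk : 1 ≤ k) (hkV : k ≤ Fintype.card V)
    (h : captureTime G k ≤ t) : copThrottling G ≤ (k + t : ℕ) := by
  push_cast
  exact (iInf₂_le k (Finset.mem_Icc.2 ⟨hk, hkV⟩)).trans (by gcongr)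

theorem le_copThrottling [Fintype V] {d : ℕ} (h : ∀ k ≤ d, captureTime G k = ⊤) :
    ((d + 1 : ℕ) : ℕ∞) ≤ copThrottling G := by
  refine le_iInf₂ fun k _ => ?_
  rcases le_or_gt k d with hk | hk
  · simp [h k hk]
  · exact le_add_right (by exact_mod_cast hk)

/-- If every vertex other than `r` threatens at most one neighbour of `r`, and `r` has more
neighbours than there are cops, then a robber at `r` who has not been caught can step to a vertex
that no cop threatens. -/
theorem exists_adj_forall_not_move {c : Fin k → V} {r : V} (hdeg : k < (G.neighborSet r).ncard)
    (hN : ∀ u, u ≠ r → {x | G.Adj r x ∧ Move G u x}.Subsingleton) (hc : ¬ Caught c r) :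
    ∃ r', G.Adj r r' ∧ ∀ i, ¬ Move G (c i) r' := by
  by_contra! hcon
  choose f hf using fun x : G.neighborSet r => hcon x x.2
  have hinj : Function.Injective f := fun x y hxy =>
    Subtype.ext (hN (c (f x)) (fun hx => hc ⟨_, hx⟩) ⟨x.2, hf x⟩ ⟨y.2, hxy ▸ hf y⟩)
  have := Nat.card_le_card_of_injective f hinj
  rw [Nat.card_fin, Nat.card_coe_set_eq] at this
  omega

/-- A robber whom no cop threatens before the cops' move survives forever, in a graph whose degrees
exceed the number of cops and in which a vertex other than `r` threatens at most one neighbour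
of `r`. -/
theorem not_copsWinWithin_of_lt_degree (hdeg : ∀ r, k < (G.neighborSet r).ncard)
    (hN : ∀ r u, u ≠ r → {x | G.Adj r x ∧ Move G u x}.Subsingleton) {c : Fin k → V} {r : V}
    (hsafe : ∀ i, ¬ Move G (c i) r) : ¬ CopsWinWithin G t c r := by
  have not_caught : ∀ {c : Fin k → V} {r : V}, (∀ i, ¬ Move G (c i) r) → ¬ Caught c r :=
    fun h ⟨i, hi⟩ => h i (Or.inl hi.symm)
  induction t generalizing c r with
  | zero => exact not_caught hsafe
  | succ t ih =>
    rintro (h | ⟨c', hm, h⟩)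
    · exact not_caught hsafe h
    · have hc' : ¬ Caught c' r := fun ⟨i, hi⟩ => hsafe i (hi ▸ hm i)
      obtain ⟨r', hadj, hr'⟩ := exists_adj_forall_not_move (hdeg r) (hN r) hc'
      exact h.elim hc' fun h => ih hr' (h r' (Or.inr hadj))

theorem captureTime_eq_top_of_lt_degree [Nonempty V] (hdeg : ∀ r, k < (G.neighborSet r).ncard)
    (hN : ∀ r u, u ≠ r → {x | G.Adj r x ∧ Move G u x}.Subsingleton) :
    captureTime G k = ⊤ := by
  refine iInf₂_eq_top.2 fun t ⟨c, hc⟩ => ?_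
  -- A vertex and its neighbours outnumber the cops, so some vertex is unoccupied.
  obtain ⟨r, hr⟩ : ∃ r, ¬ Caught c r := by
    by_contra! hcon
    obtain ⟨r₀⟩ := ‹Nonempty V›
    have hfin : Finite V := Finite.of_surjective c hcon
    have h1 := Nat.card_le_card_of_surjective c hcon
    have h2 := Set.ncard_le_card (G.neighborSet r₀)
    have h3 := hdeg r₀
    rw [Nat.card_fin] at h1
    omega
  obtain ⟨r', -, hr'⟩ := exists_adj_forall_not_move (hdeg r) (hN r) hr
  exact absurd (hc r') (not_copsWinWithin_of_lt_degree hdeg hN hr')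

end Game

/-! ### Incidence graphs of projective planes -/

section Plane

open Configuration

variable {P L : Type*} [Membership P L]

theorem ncard_neighborSet_incidenceGraph [ProjectivePlane P L] [Finite P] [Finite L]
    (r : P ⊕ L) :
    ((incidenceGraph P L).neighborSet r).ncard = ProjectivePlane.order P L + 1 := by
  rcases r with p | l
  · have h : (incidenceGraph P L).neighborSet (.inl p) = Sum.inr '' {l : L | p ∈ l} := by
      ext (x | x) <;> simp [SimpleGraph.mem_neighborSet, incidenceGraph]
    rw [h, Set.ncard_image_of_injective _ Sum.inr_injective]
    exact ProjectivePlane.lineCount_eq L p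
  · have h : (incidenceGraph P L).neighborSet (.inr l) = Sum.inl '' {p : P | p ∈ l} := by
      ext (x | x) <;> simp [SimpleGraph.mem_neighborSet, incidenceGraph]
    rw [h, Set.ncard_image_of_injective _ Sum.inl_injective]
    exact ProjectivePlane.pointCount_eq P l

/-- The incidence graph is bipartite and two points lie on at most one common line, so a vertex
other than `r` threatens at most one neighbour of `r`. -/
theorem subsingleton_adj_and_move_incidenceGraph [Nondegenerate P L] {r u : P ⊕ L} (hur : u ≠ r) :
    {x | (incidenceGraph P L).Adj r x ∧ Move (incidenceGraph P L) u x}.Subsingleton := by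
  rintro x ⟨hx, hx'⟩ y ⟨hy, hy'⟩
  rcases r with r | r <;> rcases u with u | u <;> rcases x with x | x <;> rcases y with y | y <;>
    simp [incidenceGraph, Move] at hur hx hx' hy hy' ⊢
  · exact (Nondegenerate.eq_or_eq hx' hx hy' hy).resolve_left hur
  · exact hx'.trans hy'.symm
  · exact hx'.trans hy'.symm
  · exact (Nondegenerate.eq_or_eq hx hy hx' hy').resolve_right (Ne.symm hur)

theorem captureTime_incidenceGraph_eq_top [ProjectivePlane P L] [Finite P] [Finite L] {k : ℕ}
    (hk : k ≤ ProjectivePlane.order P L) : captureTime (incidenceGraph P L) k = ⊤ := by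
  obtain ⟨p, -⟩ := @ProjectivePlane.exists_config P L _ _
  have : Nonempty (P ⊕ L) := ⟨.inl p⟩
  refine captureTime_eq_top_of_lt_degree (fun r => ?_)
    fun r u hur => subsingleton_adj_and_move_incidenceGraph hur
  rw [ncard_neighborSet_incidenceGraph]
  omega

/-- The points of a line and the lines through a point together dominate the incidence graph. -/
theorem exists_dominating_incidenceGraph [ProjectivePlane P L] [Finite P] [Finite L] :
    ∃ D : Finset (P ⊕ L), D.card ≤ 2 * (ProjectivePlane.order P L + 1) ∧
      ∀ r, ∃ d ∈ D, Move (incidenceGraph P L) d r := by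
  classical
  obtain ⟨p₀, -, -, l₀, -⟩ := @ProjectivePlane.exists_config P L _ _
  have := Fintype.ofFinite P
  have := Fintype.ofFinite L
  refine ⟨(Finset.univ.filter (· ∈ l₀)).image .inl ∪ (Finset.univ.filter (p₀ ∈ ·)).image .inr,
    ?_, ?_⟩
  · refine (Finset.card_union_le _ _).trans ?_
    rw [two_mul, ← ProjectivePlane.pointCount_eq P l₀]
    nth_rw 2 [← ProjectivePlane.lineCount_eq_pointCount p₀ l₀]
    simp only [pointCount, lineCount, Nat.card_eq_fintype_card, Fintype.card_subtype]
    exact add_le_add Finset.card_image_le Finset.card_image_le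
  · rintro (p | l)
    · by_cases hp : p = p₀
      · obtain ⟨⟨l, hl⟩⟩ : Nonempty {l : L // p₀ ∈ l} := by
          refine (Nat.card_pos_iff.1 ?_).1
          have := ProjectivePlane.two_lt_lineCount (L := L) p₀
          rw [lineCount] at this
          omega
        exact ⟨.inr l, by simp [hl], Or.inr (by simpa [incidenceGraph, hp] using hl)⟩
      · have h := HasLines.mkLine_ax (L := L) hp
        exact ⟨.inr (HasLines.mkLine hp), by simp [h.2], Or.inr h.1⟩
    · by_cases hl : l = l₀
      · obtain ⟨⟨p, hp⟩⟩ : Nonempty {p : P // p ∈ l₀} := by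
          refine (Nat.card_pos_iff.1 ?_).1
          have := ProjectivePlane.two_lt_pointCount P l₀
          rw [pointCount] at this
          omega
        exact ⟨.inl p, by simp [hp], Or.inr (by simpa [incidenceGraph, hl] using hp)⟩
      · have h := HasPoints.mkPoint_ax (P := P) hl
        exact ⟨.inl (HasPoints.mkPoint hl), by simp [h.2], Or.inr h.1⟩

end Plane

/-! ### Attaching a path -/

section VertexSum

variable {V W : Type*} {G : SimpleGraph V} {H : SimpleGraph W} {v : V} {w : W} {k : ℕ}

/-- The first summand is a retract of a vertex sum: the second one is folded onto `v`. -/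
theorem captureTime_le_captureTime_vertexSum :
    captureTime G k ≤ captureTime (vertexSum G H v w) k := by
  refine captureTime_le_of_retract (ρ := Sum.elim id fun _ => v) (ι := Sum.inl)
    (fun _ => rfl) ?_ ?_
  · rintro (a | x) (b | y) h <;> simp only [Move, vertexSum] at h ⊢ <;>
      simp at h ⊢ <;> tauto
  · rintro a b (rfl | h)
    exacts [Move.refl _ _, Or.inr h]

open Classical in
/-- The inclusion of the second summand in a vertex sum. -/
noncomputable def vertexSumInr (v : V) (w : W) (x : W) : V ⊕ {x : W // x ≠ w} :=
  if h : x = w then .inl v else .inr ⟨x, h⟩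

theorem vertexSumInr_self : vertexSumInr v w w = .inl v := by simp [vertexSumInr]

theorem vertexSumInr_of_ne {x : W} (h : x ≠ w) : vertexSumInr v w x = .inr ⟨x, h⟩ := by
  simp [vertexSumInr, h]

theorem vertexSumInr_injective : Function.Injective (vertexSumInr v w) := by
  intro x y h
  by_cases hx : x = w <;> by_cases hy : y = w <;> simp_all [vertexSumInr]

theorem move_vertexSumInr {x y : W} (h : Move H x y) :
    Move (vertexSum G H v w) (vertexSumInr v w x) (vertexSumInr v w y) := by
  rcases h with rfl | h
  · exact Move.refl _ _
  right
  by_cases hx : x = w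
  · subst hx
    rw [vertexSumInr_self, vertexSumInr_of_ne h.ne']
    exact ⟨rfl, h⟩
  by_cases hy : y = w
  · subst hy
    rw [vertexSumInr_self, vertexSumInr_of_ne h.ne]
    exact ⟨rfl, h.symm⟩
  rw [vertexSumInr_of_ne hx, vertexSumInr_of_ne hy]
  exact h

/-- From a vertex of the second summand other than the glued one, all moves stay in that
summand. -/
theorem exists_of_move_vertexSumInr {x : W} (hx : x ≠ w) {r : V ⊕ {x : W // x ≠ w}}
    (h : Move (vertexSum G H v w) (vertexSumInr v w x) r) :
    ∃ y, r = vertexSumInr v w y ∧ Move H x y := by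
  rw [vertexSumInr_of_ne hx] at h
  rcases h with rfl | h
  · exact ⟨x, (vertexSumInr_of_ne hx).symm, Move.refl _ _⟩
  rcases r with a | y
  · obtain ⟨rfl, h⟩ := h
    exact ⟨w, vertexSumInr_self.symm, Or.inr h.symm⟩
  · exact ⟨y, (vertexSumInr_of_ne y.2).symm, Or.inr h⟩

/-- A robber on the attached path, between two cops at distance at most `t`, is caught within `t`
rounds: the cop nearer to the attaching vertex walks away from it, the other one stays. -/
theorem copsWinWithin_segment {m t : ℕ} {c : Fin k → V ⊕ {x : Fin (m + 1) // x ≠ 0}}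
    {a b x : Fin (m + 1)} (ha : ∃ i, c i = vertexSumInr v 0 a)
    (hb : ∃ j, c j = vertexSumInr v 0 b) (hax : a ≤ x) (hxb : x ≤ b) (hab : b.val ≤ a + t) :
    CopsWinWithin (vertexSum G (SimpleGraph.pathGraph (m + 1)) v 0) t c (vertexSumInr v 0 x) := by
  induction t generalizing c a x with
  | zero =>
    obtain rfl : a = x := by omega
    exact .of_caught ha
  | succ t ih =>
    rcases hax.eq_or_lt with rfl | hax
    · exact .of_caught ha
    rcases hxb.eq_or_lt with rfl | hxb
    · exact .of_caught hb
    obtain ⟨i, hi⟩ := ha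
    obtain ⟨j, hj⟩ := hb
    let a' : Fin (m + 1) := ⟨a + 1, by omega⟩
    have hij : j ≠ i := by
      rintro rfl
      have := vertexSumInr_injective (hi.symm.trans hj)
      omega
    refine Or.inr ⟨Function.update c i (vertexSumInr v 0 a'), fun l => ?_, ?_⟩
    · rcases eq_or_ne l i with rfl | hl
      · rw [Function.update_self, hi]
        refine move_vertexSumInr (Or.inr ?_)
        simp [SimpleGraph.pathGraph_adj, a']
      · rw [Function.update_of_ne hl]
        exact Move.refl _ _
    have ha' : ∃ l, Function.update c i (vertexSumInr v 0 a') l = vertexSumInr v 0 a' :=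
      ⟨i, Function.update_self ..⟩
    by_cases hxa : x = a'
    · exact Or.inl (hxa ▸ ha')
    refine Or.inr fun r' hr' => ?_
    obtain ⟨y, rfl, hy⟩ := exists_of_move_vertexSumInr (by rintro rfl; simp at hax) hr'
    have hxa' : x.val ≠ a + 1 := fun h => hxa (Fin.ext h)
    have hy' : y.val = x ∨ x.val + 1 = y ∨ y.val + 1 = x := by
      rcases hy with rfl | hy
      · exact Or.inl rfl
      · exact Or.inr (SimpleGraph.pathGraph_adj.1 hy)
    rw [Fin.lt_def] at hax hxb
    refine ih ha' ⟨j, by rw [Function.update_of_ne hij, hj]⟩ ?_ ?_ ?_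
    · rw [Fin.le_def]; simp only [a']; omega
    · rw [Fin.le_def]; omega
    · simp only [a']; omega

/-- If `D` dominates `G`, then `|D|` cops on `D`, and `m / s + 2` cops spaced `s` apart along a
path of length `m` attached to `G`, win within `s` rounds. -/
theorem captureTime_vertexSum_pathGraph_le {m s : ℕ} (hs : 0 < s) (D : Finset V)
    (hD : ∀ r, ∃ d ∈ D, Move G d r) (hk : D.card + (m / s + 2) ≤ k) :
    captureTime (vertexSum G (SimpleGraph.pathGraph (m + 1)) v 0) k ≤ s := by
  classical
  -- The last station is truncated to the end of the path.
  let st : ℕ → Fin (m + 1) := fun j => ⟨min (j * s) m, by omega⟩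
  let T : Finset (V ⊕ {x : Fin (m + 1) // x ≠ 0}) :=
    D.image .inl ∪ (Finset.range (m / s + 2)).image fun j => vertexSumInr v 0 (st j)
  refine captureTime_le_of_finset T ?_ ?_ fun c hc r => ?_
  · exact ⟨vertexSumInr v 0 (st 0), Finset.mem_union_right _
      (Finset.mem_image_of_mem _ (Finset.mem_range.2 (Nat.succ_pos _)))⟩
  · refine (Finset.card_union_le _ _).trans ((add_le_add Finset.card_image_le ?_).trans hk)
    exact Finset.card_image_le.trans (Finset.card_range _).le
  rcases r with r | x
  · obtain ⟨d, hd, hdr⟩ := hD r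
    obtain ⟨i, hi⟩ := hc (.inl d) (Finset.mem_union_left _ (Finset.mem_image_of_mem _ hd))
    obtain ⟨s, rfl⟩ : ∃ s', s = s' + 1 := ⟨s - 1, by omega⟩
    refine Or.inr ⟨Function.update c i (.inl r), fun l => ?_, Or.inl ⟨i, Function.update_self ..⟩⟩
    rcases eq_or_ne l i with rfl | hl
    · rw [Function.update_self, hi]
      rcases hdr with rfl | h
      exacts [Move.refl _ _, Or.inr h]
    · rw [Function.update_of_ne hl]
      exact Move.refl _ _
  · have hst : ∀ j ≤ m / s + 1, ∃ i, c i = vertexSumInr v 0 (st j) := fun j hj =>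
      hc _ (Finset.mem_union_right _ (Finset.mem_image_of_mem _ (Finset.mem_range.2 (by omega))))
    have hxm : x.1.val ≤ m := by omega
    have hj : x.1.val / s ≤ m / s := Nat.div_le_div_right hxm
    have h1 : x.1.val / s * s ≤ x.1.val := Nat.div_mul_le_self _ _
    have h2 : x.1.val < (x.1.val / s + 1) * s :=
      (Nat.div_lt_iff_lt_mul hs).1 (Nat.lt_succ_self _)
    rw [← vertexSumInr_of_ne (v := v) x.2]
    refine copsWinWithin_segment (hst (x.1.val / s) (by omega))
      (hst (x.1.val / s + 1) (by omega)) ?_ ?_ ?_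
    · rw [Fin.le_def]; simp only [st]; omega
    · rw [Fin.le_def]; simp only [st]; omega
    · simp only [st]; rw [add_one_mul] at *; omega

end VertexSum

/-! ### Admissible graphs -/

open Configuration in
/-- The throttling number of an admissible graph exceeds the order `q` of its plane, and it is at
most `2q + 2√n` up to an additive constant. -/
theorem IsMeynielExtremalGraph.exists_copThrottling_bounds {n : ℕ} {G : SimpleGraph (Fin n)}
    (h : IsMeynielExtremalGraph n G) (hn : 25 ≤ n) :
    ∃ q : ℕ, √((n : ℝ) / 8) - 1 < q ∧ q ^ 2 ≤ n ∧
      ((q + 1 : ℕ) : ℕ∞) ≤ copThrottling G ∧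
      copThrottling G ≤ (2 * q + 2 * n.sqrt + 5 : ℕ) := by
  obtain ⟨q, -, hq, -, P, L, _, _, _, _, hord, v, m, hm, ⟨e⟩⟩ := h
  have hqn : q ≤ n.sqrt := Nat.le_sqrt'.2 (by omega)
  have hsq : n.sqrt * n.sqrt ≤ n := Nat.sqrt_le n
  refine ⟨q, (Nat.lt_of_floor_lt hq), by omega, ?_, ?_⟩
  · refine le_copThrottling fun k hk => ?_
    rw [captureTime_congr e, ← top_le_iff,
      ← captureTime_incidenceGraph_eq_top (P := P) (L := L) (hk.trans hord.ge)]
    exact captureTime_le_captureTime_vertexSum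
  · obtain ⟨D, hDc, hD⟩ := exists_dominating_incidenceGraph (P := P) (L := L)
    rw [hord] at hDc
    have h5 : 5 ≤ n.sqrt := Nat.le_sqrt.2 (by omega)
    have hms : m / (n.sqrt + 1) < n.sqrt + 1 := by
      rw [Nat.div_lt_iff_lt_mul (by omega)]
      exact lt_of_le_of_lt (by omega) (Nat.lt_succ_sqrt n)
    have hcap := captureTime_vertexSum_pathGraph_le (v := v) (m := m) (s := n.sqrt + 1)
      (k := 2 * q + n.sqrt + 4) (by omega) D hD (by omega)
    rw [← captureTime_congr e] at hcap
    have := copThrottling_le (by omega) (by rw [Fintype.card_fin]; nlinarith) hcap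
    convert this using 2
    omega

open Configuration LinearAlgebra.Projectivization in
theorem exists_isMeynielExtremalGraph {n : ℕ} (hn : 72 ≤ n) :
    ∃ G : SimpleGraph (Fin n), IsMeynielExtremalGraph n G := by
  classical
  have hn' : (72 : ℝ) ≤ n := by exact_mod_cast hn
  have h3 : (3 : ℝ) ≤ √((n : ℝ) / 8) := Real.le_sqrt_of_sq_le (by linarith)
  obtain ⟨a, ha⟩ : ∃ a, a = ⌊√((n : ℝ) / 8) - 1⌋₊ := ⟨_, rfl⟩
  have ha2 : 2 ≤ a := ha ▸ Nat.le_floor (by push_cast; linarith)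
  have ha' : (a : ℝ) ≤ √((n : ℝ) / 8) - 1 := ha ▸ Nat.floor_le (by linarith)
  obtain ⟨q, hq, haq, hqa⟩ := Nat.exists_prime_lt_and_le_two_mul a (by omega)
  -- Bertrand's postulate allows `q = 2a`, which is not a prime since `a ≥ 2`.
  have hqa' : q < 2 * a := by
    refine lt_of_le_of_ne hqa fun h => ?_
    exact Nat.not_prime_mul (by norm_num) (by omega) (h ▸ hq)
  have hqn : 2 * (q ^ 2 + q + 1) ≤ n := by
    have h8 : 8 * (a + 1) ^ 2 ≤ n := by
      have h := Real.sq_sqrt (show 0 ≤ (n : ℝ) / 8 by positivity)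
      have : (8 * (a + 1) ^ 2 : ℝ) ≤ n := by
        have := pow_le_pow_left₀ (by positivity) (show (a + 1 : ℝ) ≤ √((n : ℝ) / 8) by linarith) 2
        linarith
      exact_mod_cast this
    nlinarith
  have := Fact.mk hq
  let P := ℙ (ZMod q) (Fin 3 → ZMod q)
  have : Finite P := Quotient.finite _
  have hfin : Fintype P := Fintype.ofFinite P
  have hcard : Fintype.card P = q ^ 2 + q + 1 := by
    rw [← Nat.card_eq_fintype_card, Projectivization.card_of_finrank (ZMod q) _ (n := 3) (by simp)]
    simp [Finset.sum_range_succ]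
    ring
  have hord : ProjectivePlane.order P P = q := by
    have := ProjectivePlane.card_points P P
    rw [hcard] at this
    rcases lt_trichotomy (ProjectivePlane.order P P) q with h | h | h
    · nlinarith
    · exact h
    · nlinarith
  obtain ⟨m, hm⟩ := Nat.exists_eq_add_of_le hqn
  obtain ⟨p⟩ : Nonempty P := Fintype.card_pos_iff.1 (by omega)
  let S := vertexSum (incidenceGraph P P) (SimpleGraph.pathGraph (m + 1)) (.inl p) 0
  have hS : Fintype.card ((P ⊕ P) ⊕ {x : Fin (m + 1) // x ≠ 0}) = n := by
    simp [hcard]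
    omega
  let e := Fintype.equivFinOfCardEq hS
  exact ⟨S.map e.toEmbedding, q, hq, ha ▸ haq, ha ▸ hqa', P, P, hfin, hfin, inferInstance,
    inferInstance, hord, .inl p, m, hm.symm, ⟨(SimpleGraph.Iso.map e S).symm⟩⟩

end CopsRobbers

open CopsRobbers in
theorem mainTheorem8 :
    (∀ n : ℕ, 72 ≤ n → ∃ G : SimpleGraph (Fin n), CopsRobbers.IsMeynielExtremalGraph n G) ∧
    ∀ G : (n : ℕ) → SimpleGraph (Fin n),
      (∀ᶠ n in atTop, CopsRobbers.IsMeynielExtremalGraph n (G n)) →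
      (fun n : ℕ => ((CopsRobbers.copThrottling (G n)).toNat : ℝ)) =Θ[atTop]
        (fun n : ℕ => √(n : ℝ)) := by
  refine ⟨fun n hn => exists_isMeynielExtremalGraph hn, fun G hG => ?_⟩
  have key : ∀ᶠ n : ℕ in atTop, √(n : ℝ) ≤ 3 * ((copThrottling (G n)).toNat : ℝ) ∧
      ((copThrottling (G n)).toNat : ℝ) ≤ 9 * √(n : ℝ) := by
    filter_upwards [hG, eventually_ge_atTop 25] with n hGn hn
    obtain ⟨q, hq, hqn, hlow, hup⟩ := hGn.exists_copThrottling_bounds hn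
    -- The upper bound shows that the throttling number is finite, so `toNat` loses nothing.
    obtain ⟨N, hN⟩ := ENat.ne_top_iff_exists.1 (ne_top_of_le_ne_top (ENat.natCast_ne_top _) hup)
    rw [← hN] at hlow hup ⊢
    rw [ENat.toNat_natCast]
    have hlow' : (q : ℝ) + 1 ≤ N := by exact_mod_cast hlow
    have hup' : (N : ℝ) ≤ 2 * q + 2 * n.sqrt + 5 := by exact_mod_cast hup
    have hn1 : (1 : ℝ) ≤ √(n : ℝ) := Real.one_le_sqrt.2 (by exact_mod_cast (by omega : 1 ≤ n))
    have hqs : (q : ℝ) ≤ √(n : ℝ) := Real.le_sqrt_of_sq_le (by exact_mod_cast hqn)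
    have hns : (n.sqrt : ℝ) ≤ √(n : ℝ) := Real.nat_sqrt_le_real_sqrt
    have h9 : √(n : ℝ) / 3 ≤ √((n : ℝ) / 8) := by
      refine Real.le_sqrt_of_sq_le ?_
      rw [div_pow, Real.sq_sqrt (Nat.cast_nonneg n)]
      linarith [(Nat.cast_nonneg n : (0 : ℝ) ≤ n)]
    constructor <;> linarith
  refine ⟨IsBigO.of_bound 9 ?_, IsBigO.of_bound 3 ?_⟩
  · filter_upwards [key] with n hn
    simpa [abs_of_nonneg (Real.sqrt_nonneg _)] using hn.2
  · filter_upwards [key] with n hn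
    simpa [abs_of_nonneg (Real.sqrt_nonneg _)] using hn.1
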